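/- Let $d\ge 0$ and $N\ge 1$ be integers and equip $\mathbb{R}^d$ with the Euclidean distance. Let $\mathcal{P}_1(\mathbb{R}^d)$ be the set of Borel probability measures on $\mathbb{R}^d$ with finite first moment, and for $\mu,\nu\in\mathcal{P}_1(\mathbb{R}^d)$ let $$W_1(\mu,\nu)=\inf_{\gamma\in\Pi(\mu,\nu)}\int_{\mathbb{R}^d\times\mathbb{R}^d}|x-y|\,d\gamma(x,y),$$ where $\Pi(\mu,\nu)$ is the set of Borel probability measures on $\mathbb{R}^d\times\mathbb{R}^d$ with marginals $\mu$ and $\nu$. Let $\nu_1,\dots,\nu_N\in\mathcal{P}_1(\mathbb{R}^d)$, let $\lambda_1,\dots,\lambda_N\ge 0$ with $\sum_{i=1}^N\lambda_i=1$, and let $\nu$ be a Wasserstein median of $(\nu_1,\dots,\nu_N)$ with weights $(\lambda_1,\dots,\lambda_N)$, i.e. any minimizer of $\mu\mapsto\sum_{i=1}^N\lambda_i W_1(\nu_i,\mu)$ over $\mathcal{P}_1(\mathbb{R}^d)$. Then the following hold. 1. If $K\subset\mathbb{R}^d$ is closed and convex and every $\nu_i$ is supported on $K$, i.e. $\nu_i(\mathbb{R}^d\setminus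 K)=0$ for $i=1,\dots,N$, then $\nu$ is supported on $K$, i.e. $\nu(\mathbb{R}^d\setminus K)=0$. 2. If $V:\mathbb{R}^d\to[0,+\infty)$ is quasiconvex, i.e. $\{V\le t\}$ is convex for every $t\ge 0$, and $V$ is measurable with respect to the completions of $\nu,\nu_1,\dots,\nu_N$ (for instance, $V$ is Borel), then $$\int_{\mathbb{R}^d}V\,d\nu\le\sum_{i=1}^N\int_{\mathbb{R}^d}V\,d\nu_i,$$ where the integrals take values in $[0,+\infty]$. 3. In particular, for every $p\in(0,+\infty)$, $$\int_{\mathbb{R}^d}|x|^p\,d\nu(x)\le\sum_{i=1}^N\int_{\mathbb{R}^d}|x|^p\,d\nu_i(x),$$ where the integrals take values in $[0,+\infty]$. -/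

import Mathlib

open MeasureTheory
open scoped ENNReal NNReal

noncomputable section

namespace WassersteinMedian

variable {X : Type*} [MetricSpace X] [MeasurableSpace X] [BorelSpace X]

variable (X) in
/-- `𝒫₁(X)`: Borel probability measures for which `d(x₀, ·)` is integrable for some `x₀`. -/
def P1 : Set (ProbabilityMeasure X) :=
  {μ | ∃ x₀ : X, Integrable (fun x => dist x₀ x) (μ : Measure X)}

/-- Transport plans: probability measures on `X × X` with marginals `μ` and `ν`. -/
def transportPlans (μ ν : ProbabilityMeasure X) : Set (ProbabilityMeasure (X × X)) :=
  {γ | (γ : Measure (X × X)).map Prod.fst = μ ∧ (γ : Measure (X × X)).map Prod.snd = ν}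

/-- The Wasserstein distance of order one, `inf_γ ∫ d(x,y) dγ(x,y)`, with values in `[0, ∞]`
(it is finite on `𝒫₁(X)`). -/
def W1 (μ ν : ProbabilityMeasure X) : ℝ≥0∞ :=
  ⨅ γ ∈ transportPlans μ ν, ∫⁻ z, edist z.1 z.2 ∂(γ : Measure (X × X))

/-- The weighted dispersion functional `μ ↦ ∑ i, λ_i W₁(ν_i, μ)`. -/
def dispersion {N : ℕ} (lam : Fin N → ℝ) (ν : Fin N → ProbabilityMeasure X)
    (μ : ProbabilityMeasure X) : ℝ≥0∞ :=
  ∑ i, ENNReal.ofReal (lam i) * W1 (ν i) μ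

/-- The set of Wasserstein medians of `ν` with weights `lam`: the minimizers of the dispersion
functional over `𝒫₁(X)`. -/
def Med {N : ℕ} (lam : Fin N → ℝ) (ν : Fin N → ProbabilityMeasure X) :
    Set (ProbabilityMeasure X) :=
  {μ | μ ∈ P1 X ∧ IsMinOn (dispersion lam ν) (P1 X) μ}

end WassersteinMedian

end

/-! All three claims follow from one bound: a median gives the complement of a convex set at most
the sum of the masses the `ν i` give it (`Med.measure_compl_le_of_convex`); the integral inequality
is its layer-cake form. For compact convex `K`, take nearly optimal plans from the `ν i` to the
median. Projecting a point onto `K` brings it closer to every point of `K`, so redirecting mass that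
comes from `K` to its projection lowers the cost. The competitor must be the same for all plans, so
at each `x` only the fraction that comes from `K` in every plan is moved. By minimality almost none
of this mass lies far from `K`, while the mass left in place is at most `∑ i, ν i Kᶜ`
(`exists_partial_transport`). -/

/-! ### Compactness of convex hulls. -/

theorem IsCompact.convexHull_of_finiteDimensional {E : Type*} [NormedAddCommGroup E]
    [NormedSpace ℝ E] [FiniteDimensional ℝ E] {s : Set E} (hs : IsCompact s) :
    IsCompact (convexHull ℝ s) := by
  set n := Module.finrank ℝ E + 1
  have hcomb : ∀ f : Fin n → E, convexHull ℝ (Set.range f) =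
      Fintype.linearCombination ℝ f '' stdSimplex ℝ (Fin n) := by
    intro f
    rw [← convexHull_rangle_single_eq_stdSimplex, LinearMap.image_convexHull, ← Set.range_comp]
    congr 2
    ext i
    simp [Fintype.linearCombination_apply, Pi.single_apply]
  -- Carathéodory: `n` points suffice, so the hull is a continuous image of a compact set.
  have key : convexHull ℝ s = (fun p : (Fin n → ℝ) × (Fin n → E) => ∑ i, p.1 i • p.2 i) ''
      (stdSimplex ℝ (Fin n) ×ˢ Set.univ.pi fun _ => s) := by
    apply Set.Subset.antisymm
    · intro x hx
      rw [convexHull_eq_union] at hx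
      simp only [Set.mem_iUnion] at hx
      obtain ⟨t, hts, hai, hxt⟩ := hx
      have htne : t.Nonempty := by
        rw [← Finset.coe_nonempty, ← convexHull_nonempty_iff (𝕜 := ℝ)]
        exact ⟨x, hxt⟩
      have hcard : t.card ≤ n := by
        have := hai.card_le_finrank_succ
        rw [Fintype.card_coe] at this
        exact this.trans (Nat.succ_le_succ (Submodule.finrank_le _))
      -- Smaller simplices are padded to exactly `n` vertices by repetition.
      obtain ⟨f, hf⟩ : ∃ f : Fin n → E, Set.range f = t := by
        have : Nonempty t := htne.to_subtype
        obtain ⟨g⟩ : Nonempty (t ↪ Fin n) :=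
          Function.Embedding.nonempty_of_card_le (by simpa using hcard)
        refine ⟨fun i => ((Function.invFun g i : t) : E), ?_⟩
        rw [show (fun i => ((Function.invFun g i : t) : E)) = Subtype.val ∘ Function.invFun g from rfl,
          Set.range_comp, (Function.invFun_surjective g.injective).range_eq]
        simp
      rw [← hf, hcomb] at hxt
      obtain ⟨w, hw, rfl⟩ := hxt
      refine ⟨(w, f), ⟨hw, fun i _ => hts ?_⟩, by simp [Fintype.linearCombination_apply]⟩
      rw [← hf]
      exact Set.mem_range_self i
    · rintro _ ⟨⟨w, f⟩, ⟨hw, hf⟩, rfl⟩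
      exact (convex_convexHull ℝ s).sum_mem (fun i _ => hw.1 i) hw.2
        fun i _ => subset_convexHull ℝ s (hf i trivial)
  rw [key]
  exact ((isCompact_stdSimplex ℝ (Fin n)).prod (isCompact_univ_pi fun _ => hs)).image (by fun_prop)

/-! ### Projection onto a convex set. -/

section Projection

variable {E : Type*} [NormedAddCommGroup E] [InnerProductSpace ℝ E]

/-- The metric projection onto a closed convex set is continuous and satisfies its variational
inequality. -/
theorem exists_continuous_convex_projection [CompleteSpace E] {K : Set E} (hne : K.Nonempty)
    (hcl : IsClosed K) (hconv : Convex ℝ K) :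
    ∃ P : E → E, Continuous P ∧ (∀ x, P x ∈ K) ∧
      ∀ x, ∀ y ∈ K, inner ℝ (x - P x) (y - P x) ≤ 0 := by
  choose P hPK hP using exists_norm_eq_iInf_of_complete_convex hne hcl.isComplete hconv
  have hin : ∀ x, ∀ y ∈ K, inner ℝ (x - P x) (y - P x) ≤ 0 := fun x =>
    (norm_eq_iInf_iff_real_inner_le_zero hconv (hPK x)).1 (hP x)
  refine ⟨P, ?_, hPK, hin⟩
  refine (LipschitzWith.of_dist_le_mul (K := 1) fun x z => ?_).continuous
  have h1 := hin x (P z) (hPK z)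
  have h2 := hin z (P x) (hPK x)
  have h3 : ‖P x - P z‖ ^ 2 ≤ inner ℝ (x - z) (P x - P z) := by
    rw [← real_inner_self_eq_norm_sq]
    have e1 : inner ℝ (x - z) (P x - P z) - inner ℝ (P x - P z) (P x - P z)
        = -(inner ℝ (x - P x) (P z - P x) + inner ℝ (z - P z) (P x - P z)) := by
      simp only [inner_sub_left, inner_sub_right]
      ring
    linarith
  have h4 := real_inner_le_norm (x - z) (P x - P z)
  rw [dist_eq_norm, dist_eq_norm, NNReal.coe_one, one_mul]
  by_contra! hlt
  nlinarith [norm_nonneg (x - z)]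

theorem dist_sq_add_dist_sq_le_of_inner_nonpos {x p y : E} (h : inner ℝ (x - p) (y - p) ≤ 0) :
    dist y p ^ 2 + dist x p ^ 2 ≤ dist y x ^ 2 := by
  have : ‖y - x‖ ^ 2 = ‖y - p‖ ^ 2 - 2 * inner ℝ (y - p) (x - p) + ‖x - p‖ ^ 2 := by
    rw [← norm_sub_sq_real, sub_sub_sub_cancel_right]
  rw [real_inner_comm] at h
  simp only [dist_eq_norm]
  linarith

/-- If the gain is below `1`, the two distances add up to less than `2 * R + 1`, and the difference
of their squares is at least `δ ^ 2`. The gain is uniform in `y`. -/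
theorem dist_add_min_le_of_inner_nonpos {x p y : E} {R δ : ℝ} (hδ : 0 < δ)
    (h : inner ℝ (x - p) (y - p) ≤ 0) (hR : dist y p ≤ R) (hx : δ ≤ dist x p) :
    dist y p + min 1 (δ ^ 2 / (2 * R + 1)) ≤ dist y x := by
  have h1 := dist_sq_add_dist_sq_le_of_inner_nonpos h
  have h0 : (0 : ℝ) ≤ dist y p := dist_nonneg
  have h0' : (0 : ℝ) ≤ dist y x := dist_nonneg
  have h2 : δ ^ 2 ≤ dist x p ^ 2 := by gcongr
  by_contra! hlt
  have h3 : dist y x < dist y p + 1 := hlt.trans_le (by gcongr; exact min_le_left _ _)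
  have h4 : dist y x < dist y p + δ ^ 2 / (2 * R + 1) :=
    hlt.trans_le (by gcongr; exact min_le_right _ _)
  have h5 : (dist y x - dist y p) * (2 * R + 1) < δ ^ 2 :=
    (lt_div_iff₀ (by linarith)).1 (by linarith)
  have h6 : dist y p ≤ dist y x := by
    by_contra! hc
    nlinarith
  nlinarith

theorem dist_le_of_inner_nonpos {x p y : E} (h : inner ℝ (x - p) (y - p) ≤ 0) :
    dist y p ≤ dist y x := by
  have h1 := dist_sq_add_dist_sq_le_of_inner_nonpos h
  exact abs_le_of_sq_le_sq' (by nlinarith [sq_nonneg (dist x p)]) dist_nonneg |>.2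

end Projection

namespace WassersteinMedian

/-! ### Rerouting part of a plan. -/

section Rerouting

variable {E : Type*} [MeasurableSpace E]

/-- The factor `θ / b` depends only on the arrival point, so it multiplies the arrival density `b`;
where `b` vanishes so does `θ`. -/
theorem map_snd_withDensity_rescale {γ : Measure (E × E)} {S : Set E} (hS : MeasurableSet S)
    {μ : Measure E} {b θ : E → ℝ≥0∞} (hb : Measurable b) (hθ : Measurable θ)
    (hbγ : (γ.restrict (S ×ˢ Set.univ)).map Prod.snd = μ.withDensity b)
    (hθb : ∀ x, θ x ≤ b x) (hb1 : ∀ᵐ x ∂μ, b x ≤ 1) :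
    (γ.withDensity ((S ×ˢ Set.univ).indicator fun z => θ z.2 / b z.2)).map Prod.snd
      = μ.withDensity θ := by
  have hq : Measurable fun x => θ x / b x := hθ.div hb
  have hSu : MeasurableSet (S ×ˢ (Set.univ : Set E)) := hS.prod MeasurableSet.univ
  ext A hA
  rw [Measure.map_apply measurable_snd hA, withDensity_indicator hSu,
    withDensity_apply _ (measurable_snd hA), ← lintegral_indicator (measurable_snd hA)]
  have h1 : (Prod.snd ⁻¹' A : Set (E × E)).indicator (fun z => θ z.2 / b z.2)
      = fun z => A.indicator (fun x => θ x / b x) z.2 := by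
    ext z
    rfl
  rw [h1, ← lintegral_map (hq.indicator hA) measurable_snd, hbγ,
    lintegral_withDensity_eq_lintegral_mul _ hb (hq.indicator hA), withDensity_apply _ hA,
    ← lintegral_indicator hA]
  refine lintegral_congr_ae ?_
  filter_upwards [hb1] with x hx
  by_cases hxA : x ∈ A
  · simp only [Pi.mul_apply, Set.indicator_of_mem hxA]
    by_cases h0 : b x = 0
    · have : θ x = 0 := le_antisymm (h0 ▸ hθb x) zero_le
      simp [h0, this]
    · exact ENNReal.mul_div_cancel h0 (ne_top_of_le_ne_top ENNReal.one_ne_top hx)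
  · simp [hxA]

theorem withDensity_one_sub_add_withDensity {α : Type*} [MeasurableSpace α] (γ : Measure α)
    {w : α → ℝ≥0∞} (hw : Measurable w) (hw1 : ∀ z, w z ≤ 1) :
    γ.withDensity (1 - w) + γ.withDensity w = γ := by
  rw [← withDensity_add_right _ hw]
  have : (1 - w) + w = 1 := by
    ext z
    simp [tsub_add_cancel_of_le (hw1 z)]
  rw [this, withDensity_one]

/-- Redirecting the fraction `w` of each unit of mass arriving at `x` to `P x`. -/
noncomputable def reroute (γ : Measure (E × E)) (w : E × E → ℝ≥0∞) (P : E → E) : Measure (E × E) :=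
  γ.withDensity (1 - w) + (γ.withDensity w).map (Prod.map id P)

/-- Moving the fraction `θ x` of the mass at `x` to `P x`. -/
noncomputable def partialMap (μ : Measure E) (θ : E → ℝ≥0∞) (P : E → E) : Measure E :=
  μ.withDensity (1 - θ) + (μ.withDensity θ).map P

theorem map_fst_reroute (γ : Measure (E × E)) {w : E × E → ℝ≥0∞} (hw : Measurable w)
    (hw1 : ∀ z, w z ≤ 1) {P : E → E} (hP : Measurable P) :
    (reroute γ w P).map Prod.fst = γ.map Prod.fst := by
  have hP' : Measurable (Prod.map (id : E → E) P) := measurable_id.prodMap hP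
  rw [reroute, Measure.map_add _ _ measurable_fst, Measure.map_map measurable_fst hP']
  change _ + (γ.withDensity w).map Prod.fst = _
  rw [← Measure.map_add _ _ measurable_fst, withDensity_one_sub_add_withDensity γ hw hw1]

theorem map_snd_reroute (γ : Measure (E × E)) [IsFiniteMeasure γ] {w : E × E → ℝ≥0∞}
    (hw : Measurable w) (hw1 : ∀ z, w z ≤ 1) {P : E → E} (hP : Measurable P) {θ : E → ℝ≥0∞}
    (hθ : Measurable θ) (hθ1 : ∀ x, θ x ≤ 1)
    (h : (γ.withDensity w).map Prod.snd = (γ.map Prod.snd).withDensity θ) :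
    (reroute γ w P).map Prod.snd = partialMap (γ.map Prod.snd) θ P := by
  have hP' : Measurable (Prod.map (id : E → E) P) := measurable_id.prodMap hP
  have hrest : (γ.withDensity (1 - w)).map Prod.snd = (γ.map Prod.snd).withDensity (1 - θ) := by
    have h1 := congrArg (Measure.map Prod.snd) (withDensity_one_sub_add_withDensity γ hw hw1)
    rw [Measure.map_add _ _ measurable_snd, h] at h1
    have h2 := withDensity_one_sub_add_withDensity (γ.map Prod.snd) hθ hθ1
    ext A hA
    have h3 := congrArg (fun m => m A) (h1.trans h2.symm)
    simp only [Measure.add_apply] at h3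
    -- The unmoved part is found by subtraction, which needs finite mass.
    refine (ENNReal.add_left_inj ?_).1 h3
    refine ne_top_of_le_ne_top (measure_ne_top (γ.map Prod.snd) A) ?_
    conv_rhs => rw [← h2]
    simp
  rw [reroute, partialMap, Measure.map_add _ _ measurable_snd, hrest,
    Measure.map_map measurable_snd hP', ← h, Measure.map_map hP measurable_snd]
  rfl

theorem lintegral_reroute_add_le (γ : Measure (E × E)) {w : E × E → ℝ≥0∞}
    (hw : Measurable w) (hw1 : ∀ z, w z ≤ 1) {P : E → E} (hP : Measurable P)
    {f : E × E → ℝ≥0∞} (hf : Measurable f) {g : E → ℝ≥0∞} (hg : Measurable g)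
    (hfg : ∀ z, w z ≠ 0 → f (z.1, P z.2) + g z.2 ≤ f z) :
    ∫⁻ z, f z ∂(reroute γ w P) + ∫⁻ x, g x ∂((γ.withDensity w).map Prod.snd) ≤ ∫⁻ z, f z ∂γ := by
  have hP' : Measurable (Prod.map (id : E → E) P) := measurable_id.prodMap hP
  rw [reroute, lintegral_add_measure, lintegral_map hf hP', lintegral_map hg measurable_snd,
    add_assoc, ← lintegral_add_left (show Measurable fun z => f (Prod.map id P z) from hf.comp hP')]
  have hle : ∫⁻ z, (f (Prod.map id P z) + g z.2) ∂(γ.withDensity w)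
      ≤ ∫⁻ z, f z ∂(γ.withDensity w) := by
    rw [lintegral_withDensity_eq_lintegral_mul _ hw
        (show Measurable fun z => f (Prod.map id P z) + g z.2 from
          (hf.comp hP').add (hg.comp measurable_snd)),
      lintegral_withDensity_eq_lintegral_mul _ hw hf]
    refine lintegral_mono fun z => ?_
    by_cases h0 : w z = 0
    · simp [h0]
    · exact mul_le_mul_right (hfg z h0) _
  refine (add_le_add_right hle _).trans_eq ?_
  rw [← lintegral_add_measure, withDensity_one_sub_add_withDensity γ hw hw1]

end Rerouting

/-! ### Finiteness of `W1` and near-optimal plans. -/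

section Wasserstein

variable {X : Type*} [MetricSpace X] [MeasurableSpace X]

theorem lintegral_edist_lt_top_of_integrable {μ : Measure X} {x₀ : X}
    (h : Integrable (fun x => dist x₀ x) μ) : ∫⁻ x, edist x₀ x ∂μ < ∞ := by
  have := h.hasFiniteIntegral
  simpa [HasFiniteIntegral, Real.enorm_eq_ofReal, edist_dist] using this

theorem W1_lt_top [BorelSpace X] [SecondCountableTopology X] {μ ν : ProbabilityMeasure X} (hμ : μ ∈ P1 X)
    (hν : ν ∈ P1 X) : W1 μ ν < ∞ := by
  obtain ⟨x₀, hx⟩ := hμ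
  obtain ⟨y₀, hy⟩ := hν
  have hx := lintegral_edist_lt_top_of_integrable hx
  have hy := lintegral_edist_lt_top_of_integrable hy
  let γ : ProbabilityMeasure (X × X) := ⟨(μ : Measure X).prod ν, inferInstance⟩
  have hγ : γ ∈ transportPlans μ ν := by
    constructor
    · exact (Measure.map_fst_prod).trans (by simp)
    · exact (Measure.map_snd_prod).trans (by simp)
  refine (iInf₂_le γ hγ).trans_lt ?_
  calc ∫⁻ z, edist z.1 z.2 ∂(γ : Measure (X × X))
      ≤ ∫⁻ z, (edist x₀ z.1 + (edist x₀ y₀ + edist y₀ z.2)) ∂((μ : Measure X).prod ν) := by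
        refine lintegral_mono fun z => ?_
        refine (edist_triangle_left z.1 z.2 x₀).trans ?_
        gcongr
        exact edist_triangle _ _ _
    _ = ∫⁻ x, edist x₀ x ∂(μ : Measure X) + (edist x₀ y₀ + ∫⁻ y, edist y₀ y ∂(ν : Measure X)) := by
        rw [lintegral_add_left (by fun_prop), lintegral_add_left (by fun_prop), lintegral_const,
          lintegral_prod _ (by fun_prop), lintegral_prod _ (by fun_prop)]
        simp
    _ < ∞ := by simp [hx, hy, edist_lt_top]

theorem exists_plan_lintegral_le {μ ν : ProbabilityMeasure X} (h : W1 μ ν < ∞) {ε : ℝ≥0∞}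
    (hε : ε ≠ 0) : ∃ γ ∈ transportPlans μ ν,
      ∫⁻ z, edist z.1 z.2 ∂(γ : Measure (X × X)) ≤ W1 μ ν + ε := by
  have h1 : W1 μ ν < W1 μ ν + ε := ENNReal.lt_add_right h.ne hε
  conv_lhs at h1 => rw [W1]
  simp only [iInf_lt_iff] at h1
  obtain ⟨γ, hγ, hlt⟩ := h1
  exact ⟨γ, hγ, hlt.le⟩

end Wasserstein

theorem isProbabilityMeasure_of_map {α β : Type*} [MeasurableSpace α] [MeasurableSpace β]
    {γ : Measure α} {f : α → β} (hf : Measurable f) {ν : Measure β} [IsProbabilityMeasure ν]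
    (h : γ.map f = ν) : IsProbabilityMeasure γ :=
  ⟨by rw [← Set.preimage_univ (f := f), ← Measure.map_apply hf MeasurableSet.univ, h, measure_univ]⟩

theorem isProbabilityMeasure_partialMap {E : Type*} [MeasurableSpace E] (μ : Measure E)
    [IsProbabilityMeasure μ] {θ : E → ℝ≥0∞} (hθ : Measurable θ) (hθ1 : ∀ x, θ x ≤ 1) {P : E → E}
    (hP : Measurable P) : IsProbabilityMeasure (partialMap μ θ P) :=
  ⟨by
    rw [partialMap, Measure.add_apply, Measure.map_apply hP MeasurableSet.univ, Set.preimage_univ,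
      ← Measure.add_apply, withDensity_one_sub_add_withDensity μ hθ hθ1, measure_univ]⟩

/-! ### Mass estimates for medians. -/

section

variable {E : Type*} [NormedAddCommGroup E] [InnerProductSpace ℝ E] [FiniteDimensional ℝ E]
  [MeasurableSpace E] [BorelSpace E]

theorem partialMap_mem_P1 {μ : ProbabilityMeasure E} (hμ : μ ∈ P1 E) {θ : E → ℝ≥0∞}
    (hθ : Measurable θ) (hθ1 : ∀ x, θ x ≤ 1) {P : E → E} (hP : Measurable P)
    (hPb : Bornology.IsBounded (Set.range P)) {μ' : ProbabilityMeasure E}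
    (hμ' : (μ' : Measure E) = partialMap (μ : Measure E) θ P) : μ' ∈ P1 E := by
  obtain ⟨x₀, hx⟩ := hμ
  have hle := withDensity_one_sub_add_withDensity (μ : Measure E) hθ hθ1
  refine ⟨x₀, ?_⟩
  rw [hμ', partialMap]
  have h1 : (μ : Measure E).withDensity (1 - θ) ≤ μ := by
    conv_rhs => rw [← hle]
    exact Measure.le_add_right le_rfl
  have h2 : (μ : Measure E).withDensity θ ≤ μ := by
    conv_rhs => rw [← hle]
    exact Measure.le_add_left le_rfl
  have : IsFiniteMeasure ((μ : Measure E).withDensity θ) := isFiniteMeasure_of_le _ h2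
  refine (hx.mono_measure h1).add_measure ?_
  rw [integrable_map_measure (by fun_prop) hP.aemeasurable]
  obtain ⟨R, hR⟩ := hPb.exists_norm_le
  refine Integrable.of_bound (C := ‖x₀‖ + R) (by fun_prop) (Filter.Eventually.of_forall fun x => ?_)
  simp only [Function.comp_apply, Real.norm_eq_abs, abs_dist]
  exact (dist_le_norm_add_norm _ _).trans (by gcongr; exact hR _ ⟨x, rfl⟩)

/-- Let `γ i` be plans from `ν i` to `μ`. All but `∑ i, ν i Kᶜ` of the mass of `μ` can be moved along
`P` in such a way that in every plan only mass coming from `K` is redirected; if `P` brings the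
points of `D` closer to `K` by `c`, each plan then saves `c` per unit of mass moved from `D`. -/
theorem exists_partial_transport {ι : Type*} [Fintype ι] [Nonempty ι]
    (ν : ι → ProbabilityMeasure E) (μ : ProbabilityMeasure E) (hμ : μ ∈ P1 E)
    (γ : ι → ProbabilityMeasure (E × E)) (hγ : ∀ i, γ i ∈ transportPlans (ν i) μ)
    {K D : Set E} (hK : MeasurableSet K) (hD : MeasurableSet D) {P : E → E} (hP : Measurable P)
    (hPb : Bornology.IsBounded (Set.range P)) {c : ℝ≥0∞}
    (hle : ∀ x, ∀ y ∈ K, edist y (P x) ≤ edist y x)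
    (hc : ∀ x ∈ D, ∀ y ∈ K, edist y (P x) + c ≤ edist y x) :
    ∃ μ' ∈ P1 E, ∃ t : ℝ≥0∞, (μ : Measure E) D ≤ t + ∑ i, (ν i : Measure E) Kᶜ ∧
      ∀ i, W1 (ν i) μ' + c * t ≤ ∫⁻ z, edist z.1 z.2 ∂(γ i : Measure (E × E)) := by
  have hKu : MeasurableSet (K ×ˢ (Set.univ : Set E)) := hK.prod MeasurableSet.univ
  set β : ι → Measure E := fun i =>
    ((γ i : Measure (E × E)).restrict (K ×ˢ Set.univ)).map Prod.snd with hβ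
  have hβμ : ∀ i, β i ≤ μ := fun i => by
    rw [← (hγ i).2]
    exact Measure.map_mono Measure.restrict_le_self measurable_snd
  have hβfin : ∀ i, IsFiniteMeasure (β i) := fun i => isFiniteMeasure_of_le _ (hβμ i)
  set b : ι → E → ℝ≥0∞ := fun i => (β i).rnDeriv μ
  have hbm : ∀ i, Measurable (b i) := fun i => Measure.measurable_rnDeriv _ _
  have hbd : ∀ i, (μ : Measure E).withDensity (b i) = β i := fun i =>
    Measure.withDensity_rnDeriv_eq _ _ (Measure.absolutelyContinuous_of_le (hβμ i))
  have hb1 : ∀ i, ∀ᵐ x ∂(μ : Measure E), b i x ≤ 1 := fun i =>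
    Measure.rnDeriv_le_one_of_le (hβμ i)
  -- The minimum over `i` makes one second marginal serve all plans; the cap gives `θ ≤ 1`
  -- everywhere, not just almost everywhere.
  set θ : E → ℝ≥0∞ := fun x => min 1 (⨅ i, b i x)
  have hθm : Measurable θ := measurable_const.min (Measurable.iInf hbm)
  have hθ1 : ∀ x, θ x ≤ 1 := fun x => min_le_left _ _
  have hθb : ∀ i x, θ x ≤ b i x := fun i x => (min_le_right _ _).trans (iInf_le _ i)
  have hprob := isProbabilityMeasure_partialMap (μ : Measure E) hθm hθ1 hP
  let μ' : ProbabilityMeasure E := ⟨partialMap (μ : Measure E) θ P, hprob⟩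
  refine ⟨μ', partialMap_mem_P1 hμ hθm hθ1 hP hPb rfl, (μ : Measure E).withDensity θ D, ?_, ?_⟩
  · have hβK : ∀ i, ∫⁻ x, (1 - b i x) ∂(μ : Measure E) = (ν i : Measure E) Kᶜ := fun i => by
      have h1 : ∫⁻ x, b i x ∂(μ : Measure E) = (ν i : Measure E) K := by
        rw [← setLIntegral_univ, ← withDensity_apply _ MeasurableSet.univ, hbd i, hβ, ← (hγ i).1,
          Measure.map_apply measurable_snd MeasurableSet.univ, Set.preimage_univ,
          Measure.restrict_apply_univ, Measure.map_apply measurable_fst hK, Set.prod_univ]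
      rw [lintegral_sub (hbm i) (h1 ▸ measure_ne_top _ _) (hb1 i), h1,
        measure_compl hK (measure_ne_top _ _)]
      simp
    -- The unmoved fraction equals `1 - b j x` for a minimizing `j`, unless it is zero.
    have hpt : ∀ x, 1 ≤ θ x + ∑ i, (1 - b i x) := fun x => by
      obtain ⟨j, hj⟩ := exists_eq_ciInf_of_finite (f := fun i => b i x)
      have hs : 1 - b j x ≤ ∑ i, (1 - b i x) :=
        Finset.single_le_sum (f := fun i => 1 - b i x) (fun _ _ => zero_le) (Finset.mem_univ j)
      rcases le_total 1 (⨅ i, b i x) with h | h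
      · simp [θ, h]
      · have : θ x = b j x := by simp only [θ, min_eq_right h, hj]
        rw [this]
        exact le_add_tsub.trans (add_le_add_right hs _)
    calc (μ : Measure E) D = ∫⁻ _ in D, 1 ∂(μ : Measure E) := by simp
      _ ≤ ∫⁻ x in D, (θ x + ∑ i, (1 - b i x)) ∂(μ : Measure E) := lintegral_mono hpt
      _ = (μ : Measure E).withDensity θ D + ∑ i, ∫⁻ x in D, (1 - b i x) ∂(μ : Measure E) := by
        rw [lintegral_add_left hθm, withDensity_apply _ hD,
          lintegral_finsetSum _ fun i _ =>
            show Measurable fun x => 1 - b i x from measurable_const.sub (hbm i)]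
      _ ≤ _ := by
        gcongr with i
        rw [← hβK i]
        exact setLIntegral_le_lintegral _ _
  · intro i
    set w : E × E → ℝ≥0∞ := (K ×ˢ Set.univ).indicator fun z => θ z.2 / b i z.2 with hw
    have hwm : Measurable w := (((hθm.div (hbm i)).comp measurable_snd)).indicator hKu
    have hw1 : ∀ z, w z ≤ 1 := fun z =>
      Set.indicator_apply_le' (fun _ => ENNReal.div_le_of_le_mul (by simpa using hθb i z.2))
        (fun _ => zero_le)
    have hsnd : ((γ i : Measure (E × E)).withDensity w).map Prod.snd
        = (μ : Measure E).withDensity θ :=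
      map_snd_withDensity_rescale hK (hbm i) hθm (hbd i).symm (hθb i) (hb1 i)
    have hf' := map_fst_reroute (γ i : Measure (E × E)) hwm hw1 hP
    rw [(hγ i).1] at hf'
    have hs' := map_snd_reroute (γ i : Measure (E × E)) hwm hw1 hP hθm hθ1
      (by rw [hsnd, (hγ i).2])
    rw [(hγ i).2] at hs'
    have hprob' := isProbabilityMeasure_of_map measurable_fst hf'
    let γ' : ProbabilityMeasure (E × E) := ⟨reroute (γ i : Measure (E × E)) w P, hprob'⟩
    have hγ' : γ' ∈ transportPlans (ν i) μ' := ⟨hf', hs'⟩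
    have hcost := lintegral_reroute_add_le (γ i : Measure (E × E)) hwm hw1 hP
      (f := fun z => edist z.1 z.2) (by fun_prop) (g := D.indicator fun _ => c)
      (measurable_const.indicator hD) (fun z hz => by
        have hzK : z.1 ∈ K := by
          by_contra h
          exact hz (by simp [hw, h])
        by_cases hzD : z.2 ∈ D
        · simpa [hzD] using hc z.2 hzD z.1 hzK
        · simpa [hzD] using hle z.2 z.1 hzK)
    rw [hsnd, lintegral_indicator_const hD] at hcost
    exact (add_le_add_left (iInf₂_le γ' hγ') _).trans hcost

theorem Med.measure_compl_le_of_isCompact {N : ℕ} {lam : Fin N → ℝ}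
    (hlam : lam ∈ stdSimplex ℝ (Fin N)) {ν : Fin N → ProbabilityMeasure E} (hν : ∀ i, ν i ∈ P1 E)
    {μ : ProbabilityMeasure E} (hμ : μ ∈ Med lam ν) {K : Set E} (hK : IsCompact K)
    (hconv : Convex ℝ K) : (μ : Measure E) Kᶜ ≤ ∑ i, (ν i : Measure E) Kᶜ := by
  have hNe : Nonempty (Fin N) := by
    by_contra h
    rw [not_nonempty_iff] at h
    simpa using hlam.2
  obtain ⟨i₀⟩ := id hNe
  rcases K.eq_empty_or_nonempty with rfl | hne
  · simp only [Set.compl_empty, measure_univ]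
    exact Finset.single_le_sum (f := fun _ : Fin N => (1 : ℝ≥0∞)) (fun _ _ => zero_le)
      (Finset.mem_univ i₀)
  obtain ⟨P, hPc, hPK, hPin⟩ := exists_continuous_convex_projection hne hK.isClosed hconv
  have hfar : ∀ δ : ℝ, 0 < δ →
      (μ : Measure E) {x | δ ≤ dist x (P x)} ≤ ∑ i, (ν i : Measure E) Kᶜ := by
    intro δ hδ
    set c : ℝ := min 1 (δ ^ 2 / (2 * Metric.diam K + 1)) with hc
    have hdiam : 0 ≤ Metric.diam K := Metric.diam_nonneg
    have hcpos : 0 < c := lt_min one_pos (by positivity)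
    refine ENNReal.le_of_forall_pos_le_add fun ε hε _ => ?_
    -- With slack `c * ε` in the plans, minimality leaves `c * t ≤ c * ε`.
    have hη : ENNReal.ofReal c * ε ≠ 0 := by simp [hcpos, hε.ne']
    choose γ hγ hγc using fun i =>
      exists_plan_lintegral_le (W1_lt_top (hν i) hμ.1) hη
    obtain ⟨μ', hμ'1, t, ht, hW⟩ := exists_partial_transport ν μ hμ.1 γ hγ hK.measurableSet
      (D := {x | δ ≤ dist x (P x)}) (isClosed_le (by fun_prop) (by fun_prop)).measurableSet
      hPc.measurable (hK.isBounded.subset (Set.range_subset_iff.2 hPK)) (c := ENNReal.ofReal c)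
      (fun x y hy => by
        rw [edist_dist, edist_dist]
        exact ENNReal.ofReal_le_ofReal (dist_le_of_inner_nonpos (hPin x y hy)))
      (fun x hx y hy => by
        rw [edist_dist, edist_dist, ← ENNReal.ofReal_add dist_nonneg hcpos.le]
        exact ENNReal.ofReal_le_ofReal (dist_add_min_le_of_inner_nonpos hδ (hPin x y hy)
          (Metric.dist_le_diam_of_mem hK.isBounded hy (hPK x)) hx))
    have hsum : ∑ i, ENNReal.ofReal (lam i) = 1 := by
      rw [← ENNReal.ofReal_sum_of_nonneg fun i _ => hlam.1 i, hlam.2, ENNReal.ofReal_one]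
    have h1 : dispersion lam ν μ' + ENNReal.ofReal c * t
        ≤ dispersion lam ν μ + ENNReal.ofReal c * ε := by
      have h2 : ∑ i, ENNReal.ofReal (lam i) * (W1 (ν i) μ' + ENNReal.ofReal c * t)
          ≤ ∑ i, ENNReal.ofReal (lam i) * (W1 (ν i) μ + ENNReal.ofReal c * ε) := by
        exact Finset.sum_le_sum fun i _ => mul_le_mul_right ((hW i).trans (hγc i)) _
      simpa only [mul_add, Finset.sum_add_distrib, ← Finset.sum_mul, hsum, one_mul,
        dispersion] using h2
    have hfin : dispersion lam ν μ ≠ ∞ := by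
      refine (ENNReal.sum_lt_top.2 fun i _ => ?_).ne
      exact ENNReal.mul_lt_top ENNReal.ofReal_lt_top (W1_lt_top (hν i) hμ.1)
    have h3 : ENNReal.ofReal c * t ≤ ENNReal.ofReal c * ε :=
      (ENNReal.add_le_add_iff_left hfin).1 ((add_le_add_left (hμ.2 hμ'1) _).trans h1)
    have h4 : t ≤ ε :=
      (ENNReal.mul_le_mul_iff_right (by simpa using hcpos) ENNReal.ofReal_ne_top).1 h3
    rw [add_comm]
    exact ht.trans (add_le_add_left h4 _)
  have hcover : Kᶜ ⊆ ⋃ n : ℕ, {x | 1 / ((n : ℝ) + 1) ≤ dist x (P x)} := by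
    intro x hx
    have hpos : 0 < dist x (P x) := dist_pos.2 fun h => hx (h ▸ hPK x)
    obtain ⟨n, hn⟩ := exists_nat_one_div_lt hpos
    exact Set.mem_iUnion.2 ⟨n, hn.le⟩
  have hmono : Monotone fun n : ℕ => {x | 1 / ((n : ℝ) + 1) ≤ dist x (P x)} :=
    fun m n hmn x (hx : _ ≤ _) => (Nat.one_div_le_one_div (α := ℝ) hmn).trans hx
  refine (measure_mono hcover).trans ?_
  rw [hmono.measure_iUnion]
  exact iSup_le fun n => hfar _ (by positivity)

/-- Inner regularity gives a compact subset of `C` for each `ν i`; the hull of their union is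
compact and stays in `C`. For `μ` only monotonicity is used. -/
theorem Med.measure_compl_le_of_convex {N : ℕ} {lam : Fin N → ℝ}
    (hlam : lam ∈ stdSimplex ℝ (Fin N)) {ν : Fin N → ProbabilityMeasure E} (hν : ∀ i, ν i ∈ P1 E)
    {μ : ProbabilityMeasure E} (hμ : μ ∈ Med lam ν) {C : Set E} (hconv : Convex ℝ C)
    (hC : ∀ i, NullMeasurableSet C (ν i : Measure E)) :
    (μ : Measure E) Cᶜ ≤ ∑ i, (ν i : Measure E) Cᶜ := by
  have happrox : ∀ i, ∀ ε : ℝ≥0∞, ε ≠ 0 → ∃ K ⊆ C, IsCompact K ∧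
      (ν i : Measure E) Kᶜ ≤ (ν i : Measure E) Cᶜ + ε := by
    intro i ε hε
    obtain ⟨T, hTC, hT, hTae⟩ := (hC i).exists_measurable_subset_ae_eq
    obtain ⟨K, hKT, hK, hlt⟩ := hT.exists_isCompact_sdiff_lt (measure_ne_top (ν i : Measure E) T) hε
    refine ⟨K, hKT.trans hTC, hK, ?_⟩
    have : Kᶜ ⊆ Tᶜ ∪ T \ K := fun x hx => by
      by_cases h : x ∈ T
      · exact Or.inr ⟨h, hx⟩
      · exact Or.inl h
    refine (measure_mono this).trans ((measure_union_le _ _).trans ?_)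
    rw [measure_congr hTae.compl]
    gcongr
  refine ENNReal.le_of_forall_pos_le_add fun ε hε _ => ?_
  obtain ⟨ε', hε', hsum⟩ := ENNReal.exists_pos_sum_of_countable
    (ENNReal.coe_ne_zero.2 hε.ne') (Fin N)
  choose K hKC hK hKle using fun i => happrox i (ε' i) (ENNReal.coe_ne_zero.2 (hε' i).ne')
  set H := convexHull ℝ (⋃ i, K i) with hH
  have hHC : H ⊆ C := convexHull_min (Set.iUnion_subset hKC) hconv
  have hHK : ∀ i, K i ⊆ H := fun i => (Set.subset_iUnion K i).trans (subset_convexHull ℝ _)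
  calc (μ : Measure E) Cᶜ ≤ (μ : Measure E) Hᶜ := measure_mono (Set.compl_subset_compl.2 hHC)
    _ ≤ ∑ i, (ν i : Measure E) Hᶜ := Med.measure_compl_le_of_isCompact hlam hν hμ
        (isCompact_iUnion hK).convexHull_of_finiteDimensional (convex_convexHull ℝ _)
    _ ≤ ∑ i, ((ν i : Measure E) Cᶜ + ε' i) := by
        gcongr with i
        exact (measure_mono (Set.compl_subset_compl.2 (hHK i))).trans (hKle i)
    _ ≤ _ := by
        rw [Finset.sum_add_distrib]
        gcongr
        simpa only [tsum_fintype] using hsum.le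

/-- Layer-cake formula, with the mass bound applied to each sublevel set. -/
theorem Med.lintegral_le_of_quasiconvexOn {N : ℕ} {lam : Fin N → ℝ}
    (hlam : lam ∈ stdSimplex ℝ (Fin N)) {ν : Fin N → ProbabilityMeasure E} (hν : ∀ i, ν i ∈ P1 E)
    {μ : ProbabilityMeasure E} (hμ : μ ∈ Med lam ν) {V : E → ℝ≥0}
    (hV : QuasiconvexOn ℝ Set.univ V) (hVν : ∀ i, AEMeasurable V (ν i : Measure E))
    (hVμ : AEMeasurable V (μ : Measure E)) :
    ∫⁻ x, (V x : ℝ≥0∞) ∂(μ : Measure E) ≤ ∑ i, ∫⁻ x, (V x : ℝ≥0∞) ∂(ν i : Measure E) := by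
  have hcake : ∀ m : Measure E, AEMeasurable V m →
      ∫⁻ x, (V x : ℝ≥0∞) ∂m = ∫⁻ t in Set.Ioi (0 : ℝ), m {x | t < V x} := fun m hm => by
    rw [← lintegral_eq_lintegral_meas_lt (f := fun x => (V x : ℝ)) m (Filter.Eventually.of_forall fun x => (V x).2)
      hm.coe_nnreal_real]
    simp
  have hanti : ∀ m : Measure E, Antitone fun t : ℝ => m {x | t < V x} := fun m s t hst =>
    measure_mono fun x (hx : t < V x) => hst.trans_lt hx
  rw [hcake _ hVμ, Finset.sum_congr rfl fun i _ => hcake _ (hVν i),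
    ← lintegral_finsetSum _ fun i _ => (hanti _).measurable]
  refine setLIntegral_mono' measurableSet_Ioi fun t (ht : 0 < t) => ?_
  have hset : {x | t < V x} = {x | V x ≤ t.toNNReal}ᶜ := by
    ext x
    simp [ht.le, Real.le_toNNReal_iff_coe_le]
  rw [hset]
  refine Med.measure_compl_le_of_convex hlam hν hμ ?_ fun i => ?_
  · simpa using hV t.toNNReal
  · exact (hVν i).nullMeasurable measurableSet_Iic

end

end WassersteinMedian

/-! ### Powers of the norm and conclusion. -/

theorem quasiconvexOn_nnnorm_rpow {E : Type*} [SeminormedAddCommGroup E] [NormedSpace ℝ E] {p : ℝ}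
    (hp : 0 < p) : QuasiconvexOn ℝ Set.univ fun x : E => ‖x‖₊ ^ p := by
  intro r
  have : {x ∈ (Set.univ : Set E) | ‖x‖₊ ^ p ≤ r} = Metric.closedBall 0 ((r ^ p⁻¹ : ℝ≥0) : ℝ) := by
    ext x
    simp only [Set.mem_univ, true_and, Set.mem_ofPred_eq, mem_closedBall_zero_iff,
      NNReal.le_rpow_inv_iff hp, ← coe_nnnorm, NNReal.coe_le_coe]
  rw [this]
  exact convex_closedBall _ _

theorem mainTheorem7 {d N : ℕ} (lam : Fin N → ℝ) (hlam : lam ∈ stdSimplex ℝ (Fin N))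
    (ν : Fin N → ProbabilityMeasure (EuclideanSpace ℝ (Fin d)))
    (hν : ∀ i, ν i ∈ WassersteinMedian.P1 (EuclideanSpace ℝ (Fin d)))
    (μ : ProbabilityMeasure (EuclideanSpace ℝ (Fin d)))
    (hμ : μ ∈ WassersteinMedian.Med lam ν) :
    (∀ K : Set (EuclideanSpace ℝ (Fin d)), IsClosed K → Convex ℝ K →
      (∀ i, (ν i : Measure (EuclideanSpace ℝ (Fin d))) Kᶜ = 0) →
        (μ : Measure (EuclideanSpace ℝ (Fin d))) Kᶜ = 0) ∧
    (∀ V : EuclideanSpace ℝ (Fin d) → ℝ≥0, QuasiconvexOn ℝ Set.univ V →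
      (∀ i, AEMeasurable V (ν i : Measure (EuclideanSpace ℝ (Fin d)))) →
      AEMeasurable V (μ : Measure (EuclideanSpace ℝ (Fin d))) →
        ∫⁻ x, (V x : ℝ≥0∞) ∂(μ : Measure (EuclideanSpace ℝ (Fin d))) ≤
          ∑ i, ∫⁻ x, (V x : ℝ≥0∞) ∂(ν i : Measure (EuclideanSpace ℝ (Fin d)))) ∧
    (∀ p : ℝ, 0 < p →
      ∫⁻ x, ENNReal.ofReal (‖x‖ ^ p) ∂(μ : Measure (EuclideanSpace ℝ (Fin d))) ≤
        ∑ i, ∫⁻ x, ENNReal.ofReal (‖x‖ ^ p) ∂(ν i : Measure (EuclideanSpace ℝ (Fin d)))) := by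
  have key := fun (V : EuclideanSpace ℝ (Fin d) → ℝ≥0) =>
    WassersteinMedian.Med.lintegral_le_of_quasiconvexOn (V := V) hlam hν hμ
  refine ⟨fun K hK hconv h0 => ?_, key, fun p hp => ?_⟩
  · have := WassersteinMedian.Med.measure_compl_le_of_convex hlam hν hμ hconv
      fun i => hK.measurableSet.nullMeasurableSet
    simpa [h0] using this
  · have hm : Measurable fun x : EuclideanSpace ℝ (Fin d) => ‖x‖₊ ^ p := by fun_prop
    have hcoe : ∀ x : EuclideanSpace ℝ (Fin d),
        ENNReal.ofReal (‖x‖ ^ p) = ((‖x‖₊ ^ p : ℝ≥0) : ℝ≥0∞) := fun x => by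
      rw [← ENNReal.ofReal_coe_nnreal, NNReal.coe_rpow, coe_nnnorm]
    simpa only [hcoe] using key _ (quasiconvexOn_nnnorm_rpow hp) (fun i => hm.aemeasurable)
      hm.aemeasurable
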